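/- Let $G$ be a complex semisimple (connected, affine) algebraic group with Lie algebra $\mathfrak g$, and let $\sigma$ be a real group structure on $G$, i.e. an antiregular involution of $G$ compatible with multiplication and inverse; let $d\sigma_e\colon\mathfrak g\to\mathfrak g$ be its differential at the identity. Let $(T,B)$ be a Borel pair ($B$ a Borel subgroup, $T\subseteq B$ a maximal torus), let $\mathfrak t=\mathrm{Lie}(T)$, and let $\mathcal S$ be the corresponding set of simple roots, i.e. the set of nodes of the Dynkin diagram $\mathrm{Dyn}(G)$. Let $c\in G$ be any element with $c\,\sigma(T)c^{-1}=T$ and $c\,\sigma(B)c^{-1}=B$, let $\theta(g)=c\,\sigma(g)c^{-1}$, and let $\sigma_D\in\mathrm{Aut}(\mathrm{Dyn}(G))$ be the diagram automorphism induced by $\sigma$ ($\star$-action): $\sigma_D(\alpha)={}^{\gamma}\alpha:=\overline{\phantom{x}}\circ\alpha\circ\theta^{-1}$ for $\alpha\in\mathcal S$, where $\overline{\phantom{x}}$ is complex conjugation on $\mathbb C^{\times}$. For a nilpotent orbit $\mathcal O\subseteq\mathfrak g$, let $w(\mathcal O)\colon\mathcal S\to\mathbb N$ be its weighted Dynkin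 diagram: $w(\mathcal O)(\alpha)=d\alpha_e(t)$, where $(x,t,y)$ is an $\mathfrak{sl}_2$-triple (that is, $[t,x]=2x$, $[t,y]=-2y$, $[x,y]=t$) with $x\in\mathcal O$, $t\in\mathfrak t$ and $d\alpha_e(t)\in\mathbb N$ for all $\alpha\in\mathcal S$. For a labelling $w\colon\mathcal S\to\mathbb N$ write $\sigma_D(w)(\alpha)=w(\sigma_D(\alpha))$. Then, for every nilpotent orbit $\mathcal O\subseteq\mathfrak g$, the set $d\sigma_e(\mathcal O)$ is a nilpotent orbit, and $$w(d\sigma_e(\mathcal O))=\sigma_D(w(\mathcal O)).$$ More precisely, a labelling $w\colon \mathcal S\to\mathbb N$ is obtained from an $\mathfrak{sl}_2$-triple for $\mathcal O$ as above if and only if $\sigma_D(w)$ is obtained from such a triple for $d\sigma_e(\mathcal O)$. -/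

import Mathlib

open scoped TensorProduct Topology

noncomputable section

namespace AlgGroup

/-! ### Affine algebraic groups over `ℂ`, their points and their Lie algebras

A complex affine algebraic group `G` is given by its coordinate ring `A = 𝒪(G)`, a commutative Hopf
algebra of finite type over `ℂ`. (Hopf algebras over a field of characteristic zero are reduced, so
`G` is determined by its group of complex points.) -/

section Basic

variable (A : Type*) [CommRing A] [HopfAlgebra ℂ A]

/-- The group `G(ℂ)` of complex points of `G = Spec A`: algebra homomorphisms `A → ℂ`, with the
convolution product `(g h)(f) = ∑ g(f₁) h(f₂)`. -/
abbrev Points := WithConv (A →ₐ[ℂ] ℂ)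

/-- The linear dual of `𝒪(G)` with the convolution product. It contains `G(ℂ)` as point
evaluations, and the Lie algebra of `G` as point derivations at the identity element. -/
abbrev Dual := WithConv (A →ₗ[ℂ] ℂ)

instance : LieRing (Dual A) := LieRing.ofAssociativeRing

instance : LieAlgebra ℂ (Dual A) := LieAlgebra.ofAssociativeAlgebra

variable {A}

/-- A point of `G`, seen as a linear form on `𝒪(G)`. -/
def toDual : Points A →* Dual A where
  toFun g := WithConv.toConv g.ofConv.toLinearMap
  map_one' := AlgHom.toLinearMap_convOne
  map_mul' := AlgHom.toLinearMap_convMul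

@[simp] lemma toDual_apply (g : Points A) (f : A) : toDual g f = g f := rfl

lemma toDual_injective : Function.Injective (toDual (A := A)) := by
  intro g h hgh
  have h1 : ∀ f, g f = h f := fun f => by rw [← toDual_apply, hgh, toDual_apply]
  exact WithConv.ext (AlgHom.ext h1)

/-- `D` is a point derivation of `𝒪(G)` at the point `g`, i.e. a tangent vector of `G` at `g`. -/
def IsDerivationAt (g : Points A) (D : Dual A) : Prop :=
  ∀ a b : A, D (a * b) = g a * D b + D a * g b

/-- The linear form `D ⊗ E` on `𝒪(G) ⊗ 𝒪(G)`. -/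
def tensorForm (D E : Dual A) : A ⊗[ℂ] A →ₗ[ℂ] ℂ :=
  LinearMap.mul' ℂ ℂ ∘ₗ TensorProduct.map D.ofConv E.ofConv

lemma tensorForm_comul (D E : Dual A) (a : A) :
    tensorForm D E (Coalgebra.comul a) = (D * E) a := rfl

lemma tensorForm_mul {g h : Points A} {D E : Dual A}
    (hD : IsDerivationAt g D) (hE : IsDerivationAt h E) (x y : A ⊗[ℂ] A) :
    tensorForm D E (x * y) =
      tensorForm (toDual g) (toDual h) x * tensorForm D E y
        + tensorForm (toDual g) E x * tensorForm D (toDual h) y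
        + tensorForm D (toDual h) x * tensorForm (toDual g) E y
        + tensorForm D E x * tensorForm (toDual g) (toDual h) y := by
  induction x using TensorProduct.induction_on with
  | zero => simp
  | add x₁ x₂ h₁ h₂ => simp only [add_mul, map_add, h₁, h₂]; ring
  | tmul a a' =>
    induction y using TensorProduct.induction_on with
    | zero => simp
    | add y₁ y₂ h₁ h₂ => simp only [mul_add, map_add, h₁, h₂]; ring
    | tmul b b' =>
      have h1 := hD a b
      have h2 := hE a' b'
      simp only [tensorForm, LinearMap.comp_apply, Algebra.TensorProduct.tmul_mul_tmul,
        TensorProduct.map_tmul, LinearMap.mul'_apply, toDual_apply, h1, h2]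
      ring

lemma convMul_mul {g h : Points A} {D E : Dual A}
    (hD : IsDerivationAt g D) (hE : IsDerivationAt h E) (a b : A) :
    (D * E) (a * b) = (g * h) a * (D * E) b + (toDual g * E) a * (D * toDual h) b
        + (D * toDual h) a * (toDual g * E) b + (D * E) a * (g * h) b := by
  have := tensorForm_mul hD hE (Coalgebra.comul a) (Coalgebra.comul b)
  rw [← Bialgebra.comul_mul] at this
  simp only [tensorForm_comul] at this
  rw [← toDual_apply (g * h), ← toDual_apply (g * h), map_mul toDual g h]
  exact this

lemma tensorForm_points_mul (g h : Points A) (x y : A ⊗[ℂ] A) :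
    tensorForm (toDual g) (toDual h) (x * y) =
      tensorForm (toDual g) (toDual h) x * tensorForm (toDual g) (toDual h) y := by
  induction x using TensorProduct.induction_on with
  | zero => simp
  | add x₁ x₂ h₁ h₂ => simp only [add_mul, map_add, h₁, h₂]
  | tmul a a' =>
    induction y using TensorProduct.induction_on with
    | zero => simp
    | add y₁ y₂ h₁ h₂ => simp only [mul_add, map_add, h₁, h₂]
    | tmul b b' =>
      simp only [tensorForm, LinearMap.comp_apply, Algebra.TensorProduct.tmul_mul_tmul,
        TensorProduct.map_tmul, LinearMap.mul'_apply, toDual_apply, map_mul]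
      ring

lemma IsDerivationAt.left_mul {g : Points A} {D : Dual A} (hD : IsDerivationAt g D)
    (h : Points A) : IsDerivationAt (h * g) (toDual h * D) := by
  intro a b
  have key : ∀ x y : A ⊗[ℂ] A, tensorForm (toDual h) D (x * y) =
      tensorForm (toDual h) (toDual g) x * tensorForm (toDual h) D y
        + tensorForm (toDual h) D x * tensorForm (toDual h) (toDual g) y := by
    intro x y
    induction x using TensorProduct.induction_on with
    | zero => simp
    | add x₁ x₂ h₁ h₂ => simp only [add_mul, map_add, h₁, h₂]; ring
    | tmul a a' =>
      induction y using TensorProduct.induction_on with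
      | zero => simp
      | add y₁ y₂ h₁ h₂ => simp only [mul_add, map_add, h₁, h₂]; ring
      | tmul b b' =>
        have h2 := hD a' b'
        simp only [tensorForm, LinearMap.comp_apply, Algebra.TensorProduct.tmul_mul_tmul,
          TensorProduct.map_tmul, LinearMap.mul'_apply, toDual_apply, h2, map_mul]
        ring
  have := key (Coalgebra.comul a) (Coalgebra.comul b)
  rw [← Bialgebra.comul_mul] at this
  simp only [tensorForm_comul] at this
  rw [← toDual_apply (h * g), ← toDual_apply (h * g), map_mul toDual h g]
  exact this

lemma IsDerivationAt.right_mul {g : Points A} {D : Dual A} (hD : IsDerivationAt g D)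
    (h : Points A) : IsDerivationAt (g * h) (D * toDual h) := by
  intro a b
  have key : ∀ x y : A ⊗[ℂ] A, tensorForm D (toDual h) (x * y) =
      tensorForm (toDual g) (toDual h) x * tensorForm D (toDual h) y
        + tensorForm D (toDual h) x * tensorForm (toDual g) (toDual h) y := by
    intro x y
    induction x using TensorProduct.induction_on with
    | zero => simp
    | add x₁ x₂ h₁ h₂ => simp only [add_mul, map_add, h₁, h₂]; ring
    | tmul a a' =>
      induction y using TensorProduct.induction_on with
      | zero => simp
      | add y₁ y₂ h₁ h₂ => simp only [mul_add, map_add, h₁, h₂]; ring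
      | tmul b b' =>
        have h2 := hD a b
        simp only [tensorForm, LinearMap.comp_apply, Algebra.TensorProduct.tmul_mul_tmul,
          TensorProduct.map_tmul, LinearMap.mul'_apply, toDual_apply, h2, map_mul]
        ring
  have := key (Coalgebra.comul a) (Coalgebra.comul b)
  rw [← Bialgebra.comul_mul] at this
  simp only [tensorForm_comul] at this
  rw [← toDual_apply (g * h), ← toDual_apply (g * h), map_mul toDual g h]
  exact this

variable (A) in
/-- The Lie algebra `𝔤 = T_e G`: the point derivations of `𝒪(G)` at the identity element, with
the bracket `[D, E] = D * E - E * D` for the convolution product. -/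
def lieAlgebra : LieSubalgebra ℂ (Dual A) where
  carrier := {D | IsDerivationAt 1 D}
  zero_mem' := fun a b => by simp
  add_mem' := fun {D E} hD hE a b => by
    have h1 := hD a b
    have h2 := hE a b
    simp only [WithConv.ofConv_add, LinearMap.add_apply, h1, h2]
    ring
  smul_mem' := fun z D hD a b => by
    have h1 := hD a b
    simp only [WithConv.ofConv_smul, LinearMap.smul_apply, h1, smul_eq_mul]
    ring
  lie_mem' := fun {D E} hD hE a b => by
    have h1 := convMul_mul hD hE a b
    have h2 := convMul_mul hE hD a b
    simp only [map_one, mul_one, one_mul] at h1 h2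
    simp only [LieRing.of_associative_ring_bracket, WithConv.ofConv_sub, LinearMap.sub_apply,
      h1, h2]
    ring

/-- The adjoint action of `G` on `𝔤`, the differential at `e` of `h ↦ g h g⁻¹`: it is conjugation
by `g` in the convolution algebra. -/
def Ad (g : Points A) : lieAlgebra A →ₗ[ℂ] lieAlgebra A where
  toFun D := ⟨toDual g * D.1 * toDual g⁻¹, by
    have h : IsDerivationAt _ _ := (D.2.left_mul g).right_mul g⁻¹
    rw [mul_one, mul_inv_cancel] at h
    exact h⟩
  map_add' D E := Subtype.ext (by simp [mul_add, add_mul])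
  map_smul' z D := Subtype.ext (by
    change toDual g * (z • D.1) * toDual g⁻¹ = z • (toDual g * D.1 * toDual g⁻¹)
    rw [mul_smul_comm, smul_mul_assoc])

@[simp] lemma coe_Ad (g : Points A) (D : lieAlgebra A) :
    (Ad g D : Dual A) = toDual g * D.1 * toDual g⁻¹ := rfl

/-- `O` is a nilpotent orbit in `𝔤`: the orbit under the adjoint action of an element `v` such
that `ad v` is a nilpotent endomorphism of `𝔤`. -/
def IsNilpotentOrbit (O : Set (lieAlgebra A)) : Prop :=
  ∃ v : lieAlgebra A, IsNilpotent (LieAlgebra.ad ℂ (lieAlgebra A) v) ∧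
    O = Set.range fun g : Points A => Ad g v

/-! ### Closed subgroups, tori, Borel subgroups, semisimple groups -/

variable (A) in
/-- The Zariski topology on `G(ℂ)`, where a point `g` is identified with the maximal ideal
`ker g` of `𝒪(G)`. -/
abbrev zariskiTopology : TopologicalSpace (Points A) :=
  TopologicalSpace.induced
    (fun g => (⟨RingHom.ker g.ofConv, RingHom.ker_isPrime _⟩ : PrimeSpectrum A)) inferInstance

/-- A Zariski closed subgroup of `G(ℂ)`. -/
def IsClosedSubgroup (H : Subgroup (Points A)) : Prop :=
  IsClosed[zariskiTopology A] (H : Set (Points A))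

/-- A subgroup of `G(ℂ)` that is connected in the Zariski topology. -/
def IsConnectedSubgroup (H : Subgroup (Points A)) : Prop :=
  @IsConnected _ (zariskiTopology A) (H : Set (Points A))

variable (A) in
/-- `G` is a semisimple group: it is connected, and its radical is trivial, that is, its only
closed connected solvable normal subgroup is the trivial one. -/
structure IsSemisimple : Prop where
  connected : IsConnectedSubgroup (⊤ : Subgroup (Points A))
  radical : ∀ N : Subgroup (Points A), N.Normal → IsClosedSubgroup N → IsConnectedSubgroup N →
    Group.IsSolvable N → N = ⊥

/-- The algebra of regular functions on a closed subgroup `H`: the restrictions to `H` of the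
elements of `𝒪(G)`. -/
def regularFunctions (H : Subgroup (Points A)) : Subalgebra ℂ (H → ℂ) :=
  (AlgHom.pi fun h : H => (h : Points A).ofConv).range

lemma mem_regularFunctions {H : Subgroup (Points A)} {φ : H → ℂ} :
    φ ∈ regularFunctions H ↔ ∃ f : A, ∀ h : H, (h : Points A) f = φ h := by
  simp only [regularFunctions, AlgHom.mem_range, funext_iff]
  rfl

/-- A closed subgroup `T` is a torus if it is isomorphic to `𝔾ₘⁿ` for some `n`: there is a group
isomorphism `e : T ≃ (ℂˣ)ⁿ` that identifies the regular functions on `T` with the Laurent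
polynomials in the coordinates of `(ℂˣ)ⁿ`. -/
def IsTorus (T : Subgroup (Points A)) : Prop :=
  IsClosedSubgroup T ∧ ∃ (n : ℕ) (e : T ≃* (Fin n → ℂˣ)),
    regularFunctions T = Algebra.adjoin ℂ
      (Set.range (fun (i : Fin n) (t : T) => (e t i : ℂ)) ∪
        Set.range (fun (i : Fin n) (t : T) => ((e t i)⁻¹ : ℂ)))

/-- A Borel subgroup: a maximal closed connected solvable subgroup. -/
def IsBorel (B : Subgroup (Points A)) : Prop :=
  Maximal (fun H : Subgroup (Points A) =>
    IsClosedSubgroup H ∧ IsConnectedSubgroup H ∧ Group.IsSolvable H) B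

/-- A Borel pair `(T, B)`: a Borel subgroup `B` and a maximal torus `T` contained in it. -/
structure IsBorelPair (T B : Subgroup (Points A)) : Prop where
  torus : Maximal IsTorus T
  borel : IsBorel B
  le : T ≤ B

/-- The Lie algebra `Lie(H) ⊆ 𝔤` of a closed subgroup `H`: the point derivations that vanish on
the ideal of regular functions that are zero on `H`. -/
def lieOf (H : Subgroup (Points A)) : Submodule ℂ (lieAlgebra A) where
  carrier := {D | ∀ f : A, (∀ h ∈ H, h f = 0) → (D : Dual A) f = 0}
  zero_mem' := fun f _ => by simp
  add_mem' := fun {D E} hD hE f hf => by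
    have h1 := hD f hf
    have h2 := hE f hf
    simp [h1, h2]
  smul_mem' := fun z D hD f hf => by
    have h1 := hD f hf
    simp [h1]

/-! ### Characters, roots, simple roots, the Dynkin diagram -/

/-- The character group `𝕏(T)` of a closed subgroup `T`: the group homomorphisms `T → ℂˣ` that are
regular. -/
def characters (T : Subgroup (Points A)) : Subgroup (T →* ℂˣ) where
  carrier := {χ | (fun t : T => (χ t : ℂ)) ∈ regularFunctions T}
  one_mem' := by
    have : (fun _ : T => (1 : ℂ)) ∈ regularFunctions T := (regularFunctions T).one_mem
    simpa using this
  mul_mem' := fun {χ ψ} hχ hψ => by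
    have := (regularFunctions T).mul_mem hχ hψ
    simpa [Pi.mul_def] using this
  inv_mem' := fun {χ} hχ => by
    obtain ⟨f, hf⟩ := mem_regularFunctions.1 hχ
    refine mem_regularFunctions.2 ⟨HopfAlgebra.antipode ℂ f, fun t => ?_⟩
    have : (t : Points A) (HopfAlgebra.antipode ℂ f) = ((t⁻¹ : T) : Points A) f := rfl
    rw [this, hf]
    simp

/-- The weight space `𝔤_χ` of a character `χ` of `T` in `𝔤`. -/
def weightSpace {T : Subgroup (Points A)} (χ : characters T) : Submodule ℂ (lieAlgebra A) where
  carrier := {D | ∀ t : T, Ad (t : Points A) D = (χ.1 t : ℂ) • D}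
  zero_mem' := fun t => by simp
  add_mem' := fun {D E} hD hE t => by rw [map_add, hD t, hE t, smul_add]
  smul_mem' := fun z D hD t => by rw [map_smul, hD t, smul_comm]

/-- The set `R ⊆ 𝕏(T)` of roots: the nontrivial weights of `T` in `𝔤`. -/
def roots (T : Subgroup (Points A)) : Set (characters T) :=
  {α | α ≠ 1 ∧ weightSpace α ≠ ⊥}

/-- The positive roots: the roots whose root space is contained in `Lie(B)`. -/
def positiveRoots (T B : Subgroup (Points A)) : Set (characters T) :=
  {α | α ∈ roots T ∧ weightSpace α ≤ lieOf B}

/-- The simple roots: the positive roots that are not the sum of two positive roots. (The group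
`𝕏(T)` is written multiplicatively.) They are the nodes of the Dynkin diagram of `G`. -/
def simpleRoots (T B : Subgroup (Points A)) : Set (characters T) :=
  {α | α ∈ positiveRoots T B ∧
    ∀ β ∈ positiveRoots T B, ∀ δ ∈ positiveRoots T B, α ≠ β * δ}

open Classical in
/-- The Cartan integer `⟨β, α^∨⟩` of two simple roots: it is `2` if `α = β`, and otherwise it is
`-k` with `k` maximal such that `β + k α` is a root. These integers encode the edges of the Dynkin
diagram, with their multiplicities and arrows. -/
def cartanInteger {T B : Subgroup (Points A)} (β α : simpleRoots T B) : ℤ :=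
  if β = α then 2 else -((sSup {k : ℕ | β.1 * α.1 ^ k ∈ roots T} : ℕ) : ℤ)

/-- The group `Aut(Dyn(G))` of automorphisms of the Dynkin diagram: permutations of the simple
roots that preserve the Cartan integers. -/
def dynkinAut (T B : Subgroup (Points A)) : Subgroup (Equiv.Perm (simpleRoots T B)) where
  carrier := {π | ∀ β α, cartanInteger (π β) (π α) = cartanInteger β α}
  one_mem' := fun _ _ => rfl
  mul_mem' := fun {π ρ} hπ hρ β α => by
    rw [Equiv.Perm.mul_apply, Equiv.Perm.mul_apply, hπ, hρ]
  inv_mem' := fun {π} hπ β α => by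
    have := hπ (π⁻¹ β) (π⁻¹ α)
    simpa using this.symm

/-- The differential `dχ_e : Lie(T) → ℂ` of a character `χ` of `T`: it sends a point derivation
`D` to `D(f)`, for any `f ∈ 𝒪(G)` that restricts to `χ` on `T`. -/
def dChar {T : Subgroup (Points A)} (χ : characters T) : lieOf T →ₗ[ℂ] ℂ where
  toFun D := (D.1 : Dual A) (mem_regularFunctions.1 χ.2).choose
  map_add' D E := by simp
  map_smul' z D := by simp

lemma dChar_apply {T : Subgroup (Points A)} (χ : characters T) (D : lieOf T) (f : A)
    (hf : ∀ t : T, (t : Points A) f = χ.1 t) : dChar χ D = (D.1 : Dual A) f := by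
  have h := (mem_regularFunctions.1 χ.2).choose_spec
  rw [← sub_eq_zero]
  have h2 := D.2 ((mem_regularFunctions.1 χ.2).choose - f) (fun t ht => by
    have h3 := h ⟨t, ht⟩
    have h4 := hf ⟨t, ht⟩
    simp only at h3 h4
    rw [map_sub, h3, h4, sub_self])
  rw [map_sub] at h2
  exact h2

/-! ### Weighted Dynkin diagrams -/

/-- `w` is the labelling of the nodes of the Dynkin diagram obtained from the orbit `O`: there is
an `𝔰𝔩₂`-triple `(x, t, y)` in `𝔤` with `x ∈ O`, `t ∈ 𝔱 = Lie(T)`, and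
`dα_e(t) = w(α) ∈ ℕ` for all simple roots `α`. -/
def IsWeightedDiagram (T B : Subgroup (Points A)) (O : Set (lieAlgebra A))
    (w : simpleRoots T B → ℕ) : Prop :=
  ∃ (x y : lieAlgebra A) (t : lieOf T), x ∈ O ∧
    ⁅t.1, x⁆ = (2 : ℂ) • x ∧ ⁅t.1, y⁆ = (-2 : ℂ) • y ∧ ⁅x, y⁆ = t.1 ∧
    ∀ α : simpleRoots T B, dChar α.1 t = (w α : ℂ)

/-- The weighted Dynkin diagram `w(O)` of a nilpotent orbit `O`: the label of the node `α` is *the*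
number `dα_e(t)`, for an `𝔰𝔩₂`-triple `(x, t, y)` as in `IsWeightedDiagram`. For a nilpotent orbit
of a semisimple group such a triple exists and `t` is unique, so the infimum is taken over a set
with exactly one element. -/
def weightedDiagram (T B : Subgroup (Points A)) (O : Set (lieAlgebra A)) :
    simpleRoots T B → ℕ :=
  fun α => sInf {n | ∃ w, IsWeightedDiagram T B O w ∧ w α = n}

/-- The action of a Dynkin diagram automorphism on weighted Dynkin diagrams: the node `α` of
`π(w)` carries the label `w(π(α))`. -/
def permuteLabels {T B : Subgroup (Points A)} (π : dynkinAut T B)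
    (w : simpleRoots T B → ℕ) : simpleRoots T B → ℕ :=
  fun α => w (π.1 α)

end Basic

/-! ### Real group structures -/

section Real

variable (A : Type*) [CommRing A] [HopfAlgebra ℂ A]

/-- A real group structure `σ` on `G`: an involution of the scheme `G = Spec A` over complex
conjugation that is compatible with the multiplication and the inverse of `G`. It is given by its
comorphism, a conjugate-linear involutive ring automorphism `σ^♯` of `A` that is compatible with the
comultiplication and the antipode. -/
structure RealGroupStructure where
  comorphism : A →ₛₗ[starRingEnd ℂ] A
  comorphism_one : comorphism 1 = 1
  comorphism_mul : ∀ a b, comorphism (a * b) = comorphism a * comorphism b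
  involutive : ∀ a, comorphism (comorphism a) = a
  comul_comorphism : ∀ a, Coalgebra.comul (R := ℂ) (comorphism a) =
    TensorProduct.map comorphism comorphism (Coalgebra.comul (R := ℂ) a)
  antipode_comorphism : ∀ a,
    HopfAlgebra.antipode ℂ (comorphism a) = comorphism (HopfAlgebra.antipode ℂ a)

variable {A}

namespace RealGroupStructure

variable (σ : RealGroupStructure A)

/-- The conjugate-linear map `D ↦ (f ↦ conj (D (σ^♯ f)))` on the dual of `𝒪(G)`. -/
def onDual : Dual A →ₛₗ[starRingEnd ℂ] Dual A where
  toFun D := WithConv.toConv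
    { toFun := fun f => starRingEnd ℂ (D (σ.comorphism f))
      map_add' := fun a b => by simp
      map_smul' := fun z a => by simp [map_smulₛₗ] }
  map_add' D E := by ext; simp
  map_smul' z D := by ext; simp

@[simp] lemma onDual_apply (D : Dual A) (f : A) :
    σ.onDual D f = starRingEnd ℂ (D (σ.comorphism f)) := rfl

lemma onDual_onDual (D : Dual A) : σ.onDual (σ.onDual D) = D := by
  ext f
  simp [σ.involutive]

lemma onDual_mul (D E : Dual A) : σ.onDual (D * E) = σ.onDual D * σ.onDual E := by
  have key : ∀ x : A ⊗[ℂ] A, starRingEnd ℂ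
      (tensorForm D E (TensorProduct.map σ.comorphism σ.comorphism x)) =
        tensorForm (σ.onDual D) (σ.onDual E) x := by
    intro x
    induction x using TensorProduct.induction_on with
    | zero => simp
    | add x y hx hy => simp only [map_add, hx, hy]
    | tmul a b => simp [tensorForm]
  ext f
  have := key (Coalgebra.comul f)
  rw [← σ.comul_comorphism, tensorForm_comul, tensorForm_comul] at this
  exact this

/-- The action of `σ` on the complex points of `G`: `σ(g) = conj ∘ g ∘ σ^♯`. -/
def pointMap (g : Points A) : Points A := WithConv.toConv
  { toFun := fun f => starRingEnd ℂ (g (σ.comorphism f))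
    map_one' := by simp [σ.comorphism_one]
    map_mul' := fun a b => by simp [σ.comorphism_mul]
    map_zero' := by simp
    map_add' := fun a b => by simp
    commutes' := fun z => by
      rw [Algebra.algebraMap_eq_smul_one, map_smulₛₗ, σ.comorphism_one]
      simp }

@[simp] lemma pointMap_apply (g : Points A) (f : A) :
    σ.pointMap g f = starRingEnd ℂ (g (σ.comorphism f)) := rfl

lemma toDual_pointMap (g : Points A) : toDual (σ.pointMap g) = σ.onDual (toDual g) := rfl

/-- The involution `σ` of the group `G(ℂ)` of complex points. -/
def onPoints : Points A ≃* Points A where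
  toFun := σ.pointMap
  invFun := σ.pointMap
  left_inv g := toDual_injective (by rw [toDual_pointMap, toDual_pointMap, onDual_onDual])
  right_inv g := toDual_injective (by rw [toDual_pointMap, toDual_pointMap, onDual_onDual])
  map_mul' g h := toDual_injective (by
    simp only [map_mul, toDual_pointMap, onDual_mul])

lemma toDual_onPoints (g : Points A) : toDual (σ.onPoints g) = σ.onDual (toDual g) := rfl

lemma onPoints_onPoints (g : Points A) : σ.onPoints (σ.onPoints g) = g :=
  σ.onPoints.left_inv g

lemma isDerivationAt_onDual {g : Points A} {D : Dual A} (hD : IsDerivationAt g D) :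
    IsDerivationAt (σ.onPoints g) (σ.onDual D) := by
  intro a b
  have h := hD (σ.comorphism a) (σ.comorphism b)
  have h2 : ∀ f, σ.onPoints g f = starRingEnd ℂ (g (σ.comorphism f)) := fun _ => rfl
  rw [onDual_apply, onDual_apply, onDual_apply, σ.comorphism_mul, h, h2, h2]
  simp

/-- The differential `dσ_e : 𝔤 → 𝔤` of `σ` at the identity element: a point derivation `D` is
sent to `conj ∘ D ∘ σ^♯`. -/
def differential : lieAlgebra A →ₛₗ[starRingEnd ℂ] lieAlgebra A where
  toFun D := ⟨σ.onDual D.1, by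
    have h : IsDerivationAt _ _ := σ.isDerivationAt_onDual D.2
    rw [map_one] at h
    exact h⟩
  map_add' D E := Subtype.ext (by simp)
  map_smul' z D := Subtype.ext (by simp [map_smulₛₗ])

@[simp] lemma coe_differential (D : lieAlgebra A) :
    (σ.differential D : Dual A) = σ.onDual D.1 := rfl

/-! ### The `⋆`-action -/

/-- The antiregular automorphism `θ = inn_c ∘ σ` of `G`, i.e. `θ(g) = c σ(g) c⁻¹`. -/
def theta (c : Points A) : Points A ≃* Points A :=
  σ.onPoints.trans (MulAut.conj c)

lemma theta_apply (c g : Points A) : σ.theta c g = c * σ.onPoints g * c⁻¹ := rfl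

/-- The element `c` carries the Borel pair `(σ(T), σ(B))` to `(T, B)`: one has
`c σ(T) c⁻¹ = T` and `c σ(B) c⁻¹ = B`. -/
structure Carries (T B : Subgroup (Points A)) (c : Points A) : Prop where
  map_T : T.map (σ.theta c).toMonoidHom = T
  map_B : B.map (σ.theta c).toMonoidHom = B

lemma theta_symm (c : Points A) : (σ.theta c).symm = σ.theta (σ.onPoints c)⁻¹ := by
  ext1 g
  rw [MulEquiv.symm_apply_eq]
  simp only [theta_apply, map_mul, map_inv, onPoints_onPoints, inv_inv]
  group

lemma theta_conj_inv (c : Points A) : σ.theta (σ.onPoints (σ.onPoints c)⁻¹)⁻¹ = σ.theta c := by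
  rw [map_inv, onPoints_onPoints, inv_inv]

variable {σ} {T B : Subgroup (Points A)} {c : Points A}

lemma Carries.theta_mem (h : σ.Carries T B c) {t : Points A} (ht : t ∈ T) :
    σ.theta c t ∈ T := by
  have : σ.theta c t ∈ T.map (σ.theta c).toMonoidHom := ⟨t, ht, rfl⟩
  rwa [h.map_T] at this

lemma Carries.theta_mem_B (h : σ.Carries T B c) {b : Points A} (hb : b ∈ B) :
    σ.theta c b ∈ B := by
  have : σ.theta c b ∈ B.map (σ.theta c).toMonoidHom := ⟨b, hb, rfl⟩
  rwa [h.map_B] at this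

lemma Carries.theta_symm_mem (h : σ.Carries T B c) {t : Points A} (ht : t ∈ T) :
    (σ.theta c).symm t ∈ T := by
  have h1 := ht
  rw [← h.map_T] at h1
  obtain ⟨s, hs, rfl⟩ := h1
  have : (σ.theta c).symm ((σ.theta c) s) = s := MulEquiv.symm_apply_apply _ _
  exact this.symm ▸ hs

lemma Carries.symm (h : σ.Carries T B c) : σ.Carries T B (σ.onPoints c)⁻¹ := by
  have key : ∀ H : Subgroup (Points A), H.map (σ.theta c).toMonoidHom = H →
      H.map (σ.theta (σ.onPoints c)⁻¹).toMonoidHom = H := by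
    intro H hH
    conv_lhs => rw [← hH]
    rw [← theta_symm, Subgroup.map_map]
    have hid : (σ.theta c).symm.toMonoidHom.comp (σ.theta c).toMonoidHom = MonoidHom.id _ :=
      MonoidHom.ext fun g => (σ.theta c).symm_apply_apply g
    rw [hid, Subgroup.map_id]
  exact ⟨key T h.map_T, key B h.map_B⟩

lemma exists_conj_eq (x y : Dual A) (f : A) : ∃ f' : A, ∀ D : Dual A, (x * D * y) f = D f' := by
  have left : ∀ (x : Dual A) (f : A), ∃ f' : A, ∀ D : Dual A, (x * D) f = D f' := by
    intro x f
    let r := Coalgebra.Repr.arbitrary ℂ f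
    refine ⟨∑ i ∈ r.index, x (r.left i) • r.right i, fun D => ?_⟩
    rw [r.convMul_apply]
    simp
  have right : ∀ (x : Dual A) (f : A), ∃ f' : A, ∀ D : Dual A, (D * x) f = D f' := by
    intro x f
    let r := Coalgebra.Repr.arbitrary ℂ f
    refine ⟨∑ i ∈ r.index, x (r.right i) • r.left i, fun D => ?_⟩
    rw [r.convMul_apply]
    simp [mul_comm]
  obtain ⟨f₁, h₁⟩ := right y f
  obtain ⟨f₂, h₂⟩ := left x f₁
  exact ⟨f₂, fun D => by rw [h₁, h₂]⟩

/-- The differential `dθ_e = Ad(c) ∘ dσ_e` is given on linear forms by a comorphism of `θ`. -/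
lemma exists_theta_comorphism (σ : RealGroupStructure A) (c : Points A) (f : A) :
    ∃ f' : A, (∀ D : lieAlgebra A,
      (Ad c (σ.differential D) : Dual A) f = starRingEnd ℂ ((D : Dual A) f')) ∧
      ∀ g : Points A, σ.theta c g f = starRingEnd ℂ (g f') := by
  obtain ⟨f', hf'⟩ := exists_conj_eq (toDual c) (toDual c⁻¹) f
  refine ⟨σ.comorphism f', fun D => ?_, fun g => ?_⟩
  · rw [coe_Ad, hf', coe_differential, onDual_apply]
  · rw [← toDual_apply, theta_apply, map_mul, map_mul, hf', toDual_apply]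
    rfl

/-- The character `^γχ = σ₀ ∘ χ ∘ θ⁻¹`, where `σ₀` is complex conjugation on `ℂˣ`. -/
def starCharacter (h : σ.Carries T B c) (χ : characters T) : characters T :=
  ⟨{ toFun := fun t =>
      Units.map (starRingEnd ℂ : ℂ →* ℂ) (χ.1 ⟨(σ.theta c).symm t, h.theta_symm_mem t.2⟩)
     map_one' := by
      have : (⟨(σ.theta c).symm (1 : T), h.theta_symm_mem (1 : T).2⟩ : T) = 1 :=
        Subtype.ext (by simp)
      rw [this, map_one, map_one]
     map_mul' := fun s t => by
      have : (⟨(σ.theta c).symm (s * t : T), h.theta_symm_mem (s * t : T).2⟩ : T) =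
          ⟨(σ.theta c).symm s, h.theta_symm_mem s.2⟩ *
            ⟨(σ.theta c).symm t, h.theta_symm_mem t.2⟩ := Subtype.ext (by simp)
      rw [this, map_mul, map_mul] },
   by
    obtain ⟨f, hf⟩ := mem_regularFunctions.1 χ.2
    obtain ⟨f', -, hf'⟩ := exists_theta_comorphism σ (σ.onPoints c)⁻¹ f
    refine mem_regularFunctions.2 ⟨f', fun t => ?_⟩
    have h1 := hf ⟨(σ.theta c).symm t, h.theta_symm_mem t.2⟩
    have h2 := hf' t
    rw [← theta_symm] at h2
    simp only at h1
    rw [h2] at h1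
    simp [← h1]⟩

lemma starCharacter_apply (h : σ.Carries T B c) (χ : characters T) (t : T) :
    ((starCharacter h χ).1 t : ℂ) =
      starRingEnd ℂ (χ.1 ⟨(σ.theta c).symm t, h.theta_symm_mem t.2⟩ : ℂ) := rfl

lemma character_ext {χ ψ : characters T} (h : ∀ t, (χ.1 t : ℂ) = ψ.1 t) : χ = ψ :=
  Subtype.ext (MonoidHom.ext fun t => Units.ext (h t))

lemma starCharacter_symm (h : σ.Carries T B c) (χ : characters T) :
    starCharacter h.symm (starCharacter h χ) = χ := by
  apply character_ext
  intro t
  rw [starCharacter_apply, starCharacter_apply, Complex.conj_conj]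
  congr 3
  simp [← theta_symm]

lemma starCharacter_symm' (h : σ.Carries T B c) (χ : characters T) :
    starCharacter h (starCharacter h.symm χ) = χ := by
  apply character_ext
  intro t
  rw [starCharacter_apply, starCharacter_apply, Complex.conj_conj]
  congr 3
  simp [← theta_symm]

/-- The automorphism `χ ↦ ^γχ` of the lattice `𝕏(T)`. -/
def starLattice (h : σ.Carries T B c) : characters T ≃* characters T where
  toFun := starCharacter h
  invFun := starCharacter h.symm
  left_inv := starCharacter_symm h
  right_inv := starCharacter_symm' h
  map_mul' χ ψ := by
    apply character_ext
    intro t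
    simp only [Subgroup.coe_mul, MonoidHom.mul_apply, Units.val_mul, starCharacter_apply, map_mul]

lemma starLattice_apply (h : σ.Carries T B c) (χ : characters T) :
    starLattice h χ = starCharacter h χ := rfl

variable (σ) in
/-- The differential `dθ_e = Ad(c) ∘ dσ_e` of `θ = inn_c ∘ σ`. -/
def dTheta (c : Points A) : lieAlgebra A →ₛₗ[starRingEnd ℂ] lieAlgebra A :=
  (Ad c).comp σ.differential

lemma dTheta_apply (c : Points A) (D : lieAlgebra A) :
    σ.dTheta c D = Ad c (σ.differential D) := rfl

lemma Ad_mul (g h : Points A) (D : lieAlgebra A) : Ad (g * h) D = Ad g (Ad h D) :=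
  Subtype.ext (by simp only [coe_Ad, map_mul, mul_inv_rev, mul_assoc])

lemma Ad_one (D : lieAlgebra A) : Ad 1 D = D := Subtype.ext (by simp)

lemma differential_Ad (g : Points A) (D : lieAlgebra A) :
    σ.differential (Ad g D) = Ad (σ.onPoints g) (σ.differential D) :=
  Subtype.ext (by
    simp only [coe_differential, coe_Ad, onDual_mul, ← map_inv σ.onPoints, toDual_onPoints])

lemma differential_differential (D : lieAlgebra A) : σ.differential (σ.differential D) = D :=
  Subtype.ext (σ.onDual_onDual _)

lemma dTheta_Ad (c g : Points A) (D : lieAlgebra A) :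
    σ.dTheta c (Ad g D) = Ad (σ.theta c g) (σ.dTheta c D) := by
  rw [dTheta_apply, dTheta_apply, differential_Ad, ← Ad_mul, ← Ad_mul, theta_apply]
  congr 2
  group

lemma dTheta_symm (c : Points A) (D : lieAlgebra A) :
    σ.dTheta (σ.onPoints c)⁻¹ (σ.dTheta c D) = D := by
  rw [dTheta_apply, dTheta_apply, differential_Ad, differential_differential, ← Ad_mul,
    inv_mul_cancel, Ad_one]

lemma dTheta_mem_lieOf {H : Subgroup (Points A)} (hH : ∀ g ∈ H, σ.theta c g ∈ H)
    {D : lieAlgebra A} (hD : D ∈ lieOf H) : σ.dTheta c D ∈ lieOf H := by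
  intro f hf
  obtain ⟨f', h1, h2⟩ := exists_theta_comorphism σ c f
  have h3 : (D : Dual A) f' = 0 := hD f' fun g hg => by
    have := h2 g
    rw [hf _ (hH g hg)] at this
    simpa using this.symm
  rw [dTheta_apply, h1, h3, map_zero]

lemma dTheta_mem_weightSpace (h : σ.Carries T B c) {χ : characters T} {D : lieAlgebra A}
    (hD : D ∈ weightSpace χ) : σ.dTheta c D ∈ weightSpace (starLattice h χ) := by
  intro t
  have h1 := hD ⟨(σ.theta c).symm t, h.theta_symm_mem t.2⟩
  have h2 := congrArg (σ.dTheta c) h1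
  rw [dTheta_Ad, map_smulₛₗ] at h2
  simp only [MulEquiv.apply_symm_apply] at h2
  rw [h2, starLattice_apply, starCharacter_apply]

lemma starLattice_symm (h : σ.Carries T B c) : starLattice h.symm = (starLattice h).symm := by
  ext1 χ
  rfl

lemma starLattice_mem_roots (h : σ.Carries T B c) {α : characters T} (hα : α ∈ roots T) :
    starLattice h α ∈ roots T := by
  refine ⟨fun h1 => hα.1 ?_, ?_⟩
  · rwa [EmbeddingLike.map_eq_one_iff] at h1
  · obtain ⟨D, hD, hD0⟩ := (Submodule.ne_bot_iff _).1 hα.2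
    refine (Submodule.ne_bot_iff _).2 ⟨σ.dTheta c D, dTheta_mem_weightSpace h hD, fun h0 => hD0 ?_⟩
    rw [← dTheta_symm (σ := σ) c D, h0, map_zero]

lemma starLattice_mem_roots_iff (h : σ.Carries T B c) {α : characters T} :
    starLattice h α ∈ roots T ↔ α ∈ roots T := by
  refine ⟨fun h1 => ?_, starLattice_mem_roots h⟩
  have := starLattice_mem_roots h.symm h1
  rwa [starLattice_symm h, MulEquiv.symm_apply_apply] at this

lemma starLattice_mem_positiveRoots (h : σ.Carries T B c) {α : characters T}
    (hα : α ∈ positiveRoots T B) : starLattice h α ∈ positiveRoots T B := by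
  refine ⟨starLattice_mem_roots h hα.1, fun D hD => ?_⟩
  have h1 := dTheta_mem_weightSpace h.symm hD
  rw [starLattice_symm h, MulEquiv.symm_apply_apply] at h1
  have h2 := dTheta_mem_lieOf (fun g hg => h.theta_mem_B hg) (hα.2 h1)
  have h3 := dTheta_symm (σ := σ) (σ.onPoints c)⁻¹ D
  rw [map_inv, onPoints_onPoints, inv_inv] at h3
  rwa [h3] at h2

lemma starLattice_mem_simpleRoots (h : σ.Carries T B c) {α : characters T}
    (hα : α ∈ simpleRoots T B) : starLattice h α ∈ simpleRoots T B := by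
  refine ⟨starLattice_mem_positiveRoots h hα.1, fun β hβ δ hδ heq => ?_⟩
  refine hα.2 _ (starLattice_mem_positiveRoots h.symm hβ) _
    (starLattice_mem_positiveRoots h.symm hδ) ?_
  rw [← map_mul, ← heq, starLattice_symm h, MulEquiv.symm_apply_apply]

/-- The permutation `α ↦ ^γα` of the simple roots. -/
def starPerm (h : σ.Carries T B c) : Equiv.Perm (simpleRoots T B) where
  toFun α := ⟨starLattice h α.1, starLattice_mem_simpleRoots h α.2⟩
  invFun α := ⟨starLattice h.symm α.1, starLattice_mem_simpleRoots h.symm α.2⟩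
  left_inv α := Subtype.ext ((starLattice h).symm_apply_apply α.1)
  right_inv α := Subtype.ext ((starLattice h).apply_symm_apply α.1)

/-- The automorphism `σ_D` of the Dynkin diagram of `G` induced by the real group structure `σ`:
the image of the nontrivial element `γ` of `Gal(ℂ/ℝ)` under the `⋆`-action, `α ↦ ^γα`. -/
def sigmaD (h : σ.Carries T B c) : dynkinAut T B :=
  ⟨starPerm h, fun β α => by
    have key : ∀ k : ℕ, (starPerm h β).1 * (starPerm h α).1 ^ k ∈ roots T ↔
        β.1 * α.1 ^ k ∈ roots T := fun k => by
      rw [← starLattice_mem_roots_iff h (α := β.1 * α.1 ^ k), map_mul, map_pow]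
      rfl
    by_cases hβα : β = α
    · simp [cartanInteger, hβα]
    · have hne : starPerm h β ≠ starPerm h α := fun heq => hβα ((starPerm h).injective heq)
      simp only [cartanInteger, key, if_neg hβα, if_neg hne]⟩

end RealGroupStructure

end Real

end AlgGroup

end

/-!
The antiregular automorphism `θ = inn_c ∘ σ` preserves `T` and `B`, and its differential
`dθ_e = Ad(c) ∘ dσ_e` is a conjugate-linear automorphism of the real Lie algebra underlying `𝔤`
(`map_lie_dTheta`). Differentiating the relation between a character `χ` and `^γχ` gives
`dχ_e(dθ_e⁻¹(t)) = conj(d(^γχ)_e(t))` for `t ∈ Lie(T)` (`dChar_dTheta_symm`). Since the structure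
constants `2`, `-2`, `1` of an `𝔰𝔩₂`-triple and the labels of a weighted diagram are real, `dθ_e⁻¹`
carries a triple for `O` with labelling `w` to a triple with labelling `α ↦ w(^γα)`. As `dθ_e⁻¹`
differs from `dσ_e` by an inner automorphism, the new triple belongs to the orbit `dσ_e(O)`
(`IsWeightedDiagram.image_differential`). The converse is the same transport along `dθ_e`, applied
to the orbit `dσ_e(O)`, because `dσ_e(dσ_e(O)) = O`.
-/

namespace AlgGroup

variable {A : Type*} [CommRing A] [HopfAlgebra ℂ A]

lemma Ad_lie (g : Points A) (D E : lieAlgebra A) : Ad g ⁅D, E⁆ = ⁅Ad g D, Ad g E⁆ := by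
  have key (x y : Dual A) : toDual g * x * toDual g⁻¹ * (toDual g * y * toDual g⁻¹) =
      toDual g * (x * y) * toDual g⁻¹ := by
    have h : toDual g⁻¹ * toDual g = 1 := by rw [← map_mul, inv_mul_cancel, map_one]
    rw [show toDual g * x * toDual g⁻¹ * (toDual g * y * toDual g⁻¹) =
      toDual g * x * (toDual g⁻¹ * toDual g) * y * toDual g⁻¹ by simp only [mul_assoc], h]
    simp only [mul_assoc, one_mul]
  apply Subtype.ext
  simp only [coe_Ad, LieSubalgebra.coe_bracket, LieRing.of_associative_ring_bracket, key, mul_sub,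
    sub_mul]

namespace IsNilpotentOrbit

lemma Ad_mem {O : Set (lieAlgebra A)} (hO : IsNilpotentOrbit O) (g : Points A)
    {x : lieAlgebra A} (hx : x ∈ O) : Ad g x ∈ O := by
  obtain ⟨v, -, rfl⟩ := hO
  obtain ⟨h, rfl⟩ := hx
  exact ⟨g * h, RealGroupStructure.Ad_mul g h v⟩

end IsNilpotentOrbit

namespace RealGroupStructure

variable {σ : RealGroupStructure A} {T B : Subgroup (Points A)} {c : Points A}

variable (σ) in
lemma differential_lie (D E : lieAlgebra A) :
    σ.differential ⁅D, E⁆ = ⁅σ.differential D, σ.differential E⁆ := by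
  apply Subtype.ext
  simp only [coe_differential, LieSubalgebra.coe_bracket, LieRing.of_associative_ring_bracket,
    map_sub, onDual_mul]

lemma map_lie_dTheta (c : Points A) (D E : lieAlgebra A) :
    σ.dTheta c ⁅D, E⁆ = ⁅σ.dTheta c D, σ.dTheta c E⁆ := by
  simp only [dTheta_apply, differential_lie, Ad_lie]

variable (σ) in
lemma differential_image_image (O : Set (lieAlgebra A)) :
    σ.differential '' (σ.differential '' O) = O := by
  simp [Set.image_image, differential_differential]

variable (σ) in
lemma isNilpotent_ad_differential {v : lieAlgebra A}
    (hv : IsNilpotent (LieAlgebra.ad ℂ (lieAlgebra A) v)) :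
    IsNilpotent (LieAlgebra.ad ℂ (lieAlgebra A) (σ.differential v)) := by
  obtain ⟨n, hn⟩ := hv
  have key (k : ℕ) (D : lieAlgebra A) :
      ((LieAlgebra.ad ℂ (lieAlgebra A) (σ.differential v)) ^ k) (σ.differential D) =
        σ.differential (((LieAlgebra.ad ℂ (lieAlgebra A) v) ^ k) D) := by
    induction k with
    | zero => simp
    | succ k ih =>
      rw [pow_succ', pow_succ', Module.End.mul_apply, Module.End.mul_apply, ih,
        LieAlgebra.ad_apply, LieAlgebra.ad_apply, differential_lie]
  refine ⟨n, LinearMap.ext fun D => ?_⟩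
  rw [← differential_differential (σ := σ) D, key, hn]
  simp

variable (σ) in
lemma isNilpotentOrbit_image_differential {O : Set (lieAlgebra A)} (hO : IsNilpotentOrbit O) :
    IsNilpotentOrbit (σ.differential '' O) := by
  obtain ⟨v, hv, rfl⟩ := hO
  refine ⟨σ.differential v, σ.isNilpotent_ad_differential hv, ?_⟩
  ext D
  constructor
  · rintro ⟨_, ⟨g, rfl⟩, rfl⟩
    exact ⟨σ.onPoints g, (differential_Ad g v).symm⟩
  · rintro ⟨g, rfl⟩
    refine ⟨_, ⟨σ.onPoints g, rfl⟩, ?_⟩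
    rw [differential_Ad, onPoints_onPoints]

/-- The differential at `e` of the identity `χ ∘ θ⁻¹ = conj ∘ ^γχ`. -/
lemma dChar_dTheta_symm (h : σ.Carries T B c) (χ : characters T) (t : lieOf T) :
    dChar χ ⟨σ.dTheta (σ.onPoints c)⁻¹ t.1,
        dTheta_mem_lieOf (fun _ hg => h.symm.theta_mem hg) t.2⟩ =
      starRingEnd ℂ (dChar (starLattice h χ) t) := by
  obtain ⟨f, hf⟩ := mem_regularFunctions.1 χ.2
  -- `f'` is the comorphism of `θ⁻¹` applied to `f`; its restriction to `T` is `^γχ`.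
  obtain ⟨f', hD, hg⟩ := exists_theta_comorphism σ (σ.onPoints c)⁻¹ f
  rw [dChar_apply χ _ f hf, dChar_apply (starLattice h χ) t f']
  · exact hD t.1
  intro s
  rw [starLattice_apply, starCharacter_apply, ← hf ⟨_, h.theta_symm_mem s.2⟩]
  simp only [theta_symm, hg, Complex.conj_conj]

end RealGroupStructure

open RealGroupStructure

variable {σ : RealGroupStructure A} {T B : Subgroup (Points A)} {c : Points A}

/-- Transport of an `𝔰𝔩₂`-triple along `dθ_e⁻¹`. -/
lemma IsWeightedDiagram.image_differential (h : σ.Carries T B c) {O : Set (lieAlgebra A)}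
    (hO : IsNilpotentOrbit O) {w : simpleRoots T B → ℕ} (hw : IsWeightedDiagram T B O w) :
    IsWeightedDiagram T B (σ.differential '' O) (permuteLabels (sigmaD h) w) := by
  obtain ⟨x, y, t, hx, htx, hty, hxy, hα⟩ := hw
  refine ⟨σ.dTheta (σ.onPoints c)⁻¹ x, σ.dTheta (σ.onPoints c)⁻¹ y,
    ⟨σ.dTheta (σ.onPoints c)⁻¹ t.1, dTheta_mem_lieOf (fun _ hg => h.symm.theta_mem hg) t.2⟩,
    ?_, ?_, ?_, ?_, fun α => ?_⟩
  · rw [dTheta_apply]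
    exact (σ.isNilpotentOrbit_image_differential hO).Ad_mem _ (Set.mem_image_of_mem _ hx)
  · rw [← map_lie_dTheta, htx, map_smulₛₗ, map_ofNat]
  · rw [← map_lie_dTheta, hty, map_smulₛₗ, map_neg, map_ofNat]
  · rw [← map_lie_dTheta, hxy]
  · rw [dChar_dTheta_symm h]
    exact (congrArg (starRingEnd ℂ) (hα ((sigmaD h).1 α))).trans (Complex.conj_natCast _)

lemma isWeightedDiagram_image_differential_iff (h : σ.Carries T B c) {O : Set (lieAlgebra A)}
    (hO : IsNilpotentOrbit O) (w : simpleRoots T B → ℕ) :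
    IsWeightedDiagram T B O w ↔
      IsWeightedDiagram T B (σ.differential '' O) (permuteLabels (sigmaD h) w) := by
  refine ⟨fun hw => hw.image_differential h hO, fun hw => ?_⟩
  -- The element `σ(c)⁻¹` belongs to `θ⁻¹`, so it induces the inverse diagram automorphism.
  have hw' := hw.image_differential h.symm (σ.isNilpotentOrbit_image_differential hO)
  have hperm : permuteLabels (sigmaD h.symm) (permuteLabels (sigmaD h) w) = w :=
    funext fun α => congrArg w ((starPerm h).apply_symm_apply α)
  rwa [differential_image_image, hperm] at hw'

lemma weightedDiagram_image_differential (h : σ.Carries T B c) {O : Set (lieAlgebra A)}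
    (hO : IsNilpotentOrbit O) :
    weightedDiagram T B (σ.differential '' O) =
      permuteLabels (sigmaD h) (weightedDiagram T B O) := by
  have hsurj : Function.Surjective (permuteLabels (sigmaD h)) := fun w =>
    ⟨fun α => w ((sigmaD h).1.symm α),
      funext fun α => congrArg w ((sigmaD h).1.symm_apply_apply α)⟩
  funext α
  simp only [weightedDiagram, permuteLabels]
  congr 1
  ext n
  constructor
  · rintro ⟨w, hw, hn⟩
    obtain ⟨w, rfl⟩ := hsurj w
    exact ⟨w, (isWeightedDiagram_image_differential_iff h hO w).2 hw, hn⟩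
  · rintro ⟨w, hw, hn⟩
    exact ⟨_, hw.image_differential h hO, hn⟩

end AlgGroup

theorem proposition3p2 {A : Type*} [CommRing A] [HopfAlgebra ℂ A] [Algebra.FiniteType ℂ A]
    (hG : AlgGroup.IsSemisimple A) (σ : AlgGroup.RealGroupStructure A)
    {T B : Subgroup (AlgGroup.Points A)} (hTB : AlgGroup.IsBorelPair T B)
    {c : AlgGroup.Points A} (hc : σ.Carries T B c)
    {O : Set (AlgGroup.lieAlgebra A)} (hO : AlgGroup.IsNilpotentOrbit O) :
    AlgGroup.IsNilpotentOrbit (σ.differential '' O) ∧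
    (∀ w : AlgGroup.simpleRoots T B → ℕ, AlgGroup.IsWeightedDiagram T B O w ↔
      AlgGroup.IsWeightedDiagram T B (σ.differential '' O)
        (AlgGroup.permuteLabels (AlgGroup.RealGroupStructure.sigmaD hc) w)) ∧
    AlgGroup.weightedDiagram T B (σ.differential '' O) =
      AlgGroup.permuteLabels (AlgGroup.RealGroupStructure.sigmaD hc) (AlgGroup.weightedDiagram T B O) := by
  exact ⟨σ.isNilpotentOrbit_image_differential hO,
    AlgGroup.isWeightedDiagram_image_differential_iff hc hO,
    AlgGroup.weightedDiagram_image_differential hc hO⟩
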